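/- Let $H$ be a separable infinite-dimensional complex Hilbert space, let $J$ be a two-sided ideal of the ring $B(H)$ of bounded linear operators on $H$, and let $S, T \in J$. Suppose that $S$ and $T$ are simultaneously diagonalizable with disjoint supports, that is, there are an orthonormal basis $(e_n)$ of $H$ and complex sequences $(d_n)$, $(d_n')$ with $Se_n = d_n e_n$, $Te_n = d_n' e_n$ and $d_n d_n' = 0$ for all $n$; and suppose that their s-number sequences are equivalent, that is, there are constants $a, b > 0$ with $a\, s_n(S) \le s_n(T) \le b\, s_n(S)$ for all $n$. Call a complex linear subspace $\mathcal I \subseteq J$ a linear $J$-ideal if $AX, XA \in \mathcal I$ for all $A \in J$, $X \in \mathcal I$; for $\mathscr S \subseteq J$ let $(\mathscr S)_J$ be the smallest linear $J$-ideal containing $\mathscr S$, and let $(\mathscr S)$ be the smallest two-sided ideal of $B(H)$ containing $\mathscr S$. Then $(\{S,T\})_J$ is a principal linear $J$-ideal (i.e. $(\{S,T\})_J = (\{A\})_J$ for some $A \in J$) if and only if the ideal $(\{S,T\})$ is $J$-soft, i.e. $(\{S,T\})\,J = (\{S,T\})$, where the product of two ideals is the set of finite sums of products of their elements. -/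

import Mathlib

noncomputable section

namespace Subideal

variable {H : Type*} [NormedAddCommGroup H] [InnerProductSpace ℂ H] [CompleteSpace H]

/-- The `n`-th s-number (`n = 0, 1, 2, …`) of a bounded operator `T`: the distance, in operator
norm, from `T` to the operators of rank at most `n`.  For compact `T` this is the `n`-th
eigenvalue of `|T|` in non-increasing order, counted with multiplicity. -/
def sNumber (T : H →L[ℂ] H) (n : ℕ) : ℝ :=
  sInf {r : ℝ | ∃ F : H →L[ℂ] H, (F : H →ₗ[ℂ] H).rank ≤ (n : Cardinal) ∧ r = ‖T - F‖}

/-- Equivalence of the s-number sequences: `a s(S) ≤ s(T) ≤ b s(S)` for some `a, b > 0`. -/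
def SNumberEquiv (S T : H →L[ℂ] H) : Prop :=
  ∃ a b : ℝ, 0 < a ∧ 0 < b ∧
    ∀ n : ℕ, a * sNumber S n ≤ sNumber T n ∧ sNumber T n ≤ b * sNumber S n

/-- `S` and `T` are diagonal with respect to one and the same orthonormal basis, and their
diagonal sequences have disjoint supports. -/
def SimulDiagDisjoint (S T : H →L[ℂ] H) : Prop :=
  ∃ (e : HilbertBasis ℕ ℂ H) (d₁ d₂ : ℕ → ℂ),
    (∀ n, S (e n) = d₁ n • e n) ∧ (∀ n, T (e n) = d₂ n • e n) ∧
      Disjoint (Function.support d₁) (Function.support d₂)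

/-- The product of two `B(H)`-ideals: the finite sums of products `a * b` with `a ∈ I`, `b ∈ J`. -/
def idealProd (I J : TwoSidedIdeal (H →L[ℂ] H)) : TwoSidedIdeal (H →L[ℂ] H) :=
  TwoSidedIdeal.mk'
    (AddSubgroup.closure {x : H →L[ℂ] H | ∃ a ∈ I, ∃ b ∈ J, x = a * b} : Set (H →L[ℂ] H))
    (zero_mem _) (fun hx hy => add_mem hx hy) (fun hx => neg_mem hx)
    (by
      intro x y hy
      simp only [SetLike.mem_coe] at hy ⊢
      induction hy using AddSubgroup.closure_induction with
      | mem y hy =>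
        obtain ⟨a, ha, b, hb, rfl⟩ := hy
        exact AddSubgroup.subset_closure ⟨x * a, I.mul_mem_left _ _ ha, b, hb, by rw [mul_assoc]⟩
      | zero => simp
      | add y z _ _ hy hz => rw [mul_add]; exact add_mem hy hz
      | neg y _ hy => rw [mul_neg]; exact neg_mem hy)
    (by
      intro y x hy
      simp only [SetLike.mem_coe] at hy ⊢
      induction hy using AddSubgroup.closure_induction with
      | mem y hy =>
        obtain ⟨a, ha, b, hb, rfl⟩ := hy
        exact AddSubgroup.subset_closure ⟨a, ha, b * x, J.mul_mem_right _ _ hb, by rw [mul_assoc]⟩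
      | zero => simp
      | add y z _ _ hy hz => rw [add_mul]; exact add_mem hy hz
      | neg y _ hy => rw [neg_mul]; exact neg_mem hy)

/-- The `B(H)`-ideal `I` is `J`-soft: `IJ = I`. -/
def IsSoft (J I : TwoSidedIdeal (H →L[ℂ] H)) : Prop :=
  idealProd I J = I

/-- `I` is a linear `J`-ideal: a complex linear subspace of `J` closed under left and right
multiplication by the elements of `J`. -/
def IsLinearIdeal (J : TwoSidedIdeal (H →L[ℂ] H)) (I : Submodule ℂ (H →L[ℂ] H)) : Prop :=
  (∀ x ∈ I, x ∈ J) ∧ ∀ a ∈ J, ∀ x ∈ I, a * x ∈ I ∧ x * a ∈ I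

/-- The linear `J`-ideal `(𝒮)_J` generated by a set `𝒮` of operators in `J`: the intersection of
all linear `J`-ideals that contain `𝒮`. -/
def linearIdealSpan (J : TwoSidedIdeal (H →L[ℂ] H)) (𝒮 : Set (H →L[ℂ] H)) :
    Submodule ℂ (H →L[ℂ] H) :=
  sInf {I : Submodule ℂ (H →L[ℂ] H) | IsLinearIdeal J I ∧ 𝒮 ⊆ I}

/-- `I` is a principal linear `J`-ideal: `I = (A)_J` for a single operator `A ∈ J`. -/
def IsPrincipalLinearIdeal (J : TwoSidedIdeal (H →L[ℂ] H))
    (I : Submodule ℂ (H →L[ℂ] H)) : Prop :=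
  ∃ A ∈ J, I = linearIdealSpan J {A}

end Subideal

end

noncomputable section

namespace Subideal

variable {H : Type*} [NormedAddCommGroup H] [InnerProductSpace ℂ H] [CompleteSpace H]

/-! Write I = ({S, T}), an ideal of B(H) inside J. Multiplying an element of I by an element of J,
on either side, lands in IJ = JI. So modulo IJ a linear J-ideal generated by elements of I is just
the linear span of its generators.

If ({S, T})_J = (A)_J, then S and T are both multiples of A modulo IJ, hence linearly dependent
there. Disjointness of supports supplies a coordinate projection that isolates S, so S or T lies in
IJ. Equivalence of s-numbers puts the other one there too (`mem_of_sNumber_le`), and I = IJ.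

Conversely, I = IJ gives I = JIJ, so any subset generating I as a B(H)-ideal already generates it as
a linear J-ideal (`linearIdealSpan_eq_of_isSoft`). The single operator S + T is such a generator. -/

/-- Douglas factorization. -/
theorem exists_eq_mul_of_norm_le {A B : H →L[ℂ] H} (h : ∀ v, ‖A v‖ ≤ ‖B v‖) :
    ∃ D : H →L[ℂ] H, A = D * B := by
  let K : Submodule ℂ H := (LinearMap.range B.toLinearMap).topologicalClosure
  have hK : ∀ v, B v ∈ K := fun v =>
    Submodule.le_topologicalClosure _ (LinearMap.mem_range_self B.toLinearMap v)
  have : CompleteSpace K := (Submodule.isClosed_topologicalClosure _).completeSpace_coe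
  let e : H →ₗ[ℂ] K := B.toLinearMap.codRestrict K hK
  have hd : DenseRange e := by
    intro y
    rw [closure_subtype]
    refine closure_mono ?_ y.2
    rintro _ ⟨v, rfl⟩
    exact ⟨e v, ⟨v, rfl⟩, rfl⟩
  have hn : ∃ C, ∀ v, ‖A.toLinearMap v‖ ≤ C * ‖e v‖ := ⟨1, fun v => by
    rw [one_mul]; exact h v⟩
  refine ⟨(A.toLinearMap.extendOfNorm e).comp K.orthogonalProjectionOnto, ?_⟩
  ext v
  have : K.orthogonalProjectionOnto (B v) = e v :=
    Submodule.orthogonalProjectionOnto_mem_subspace_eq_self (⟨B v, hK v⟩ : K)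
  simp [this, LinearMap.extendOfNorm_eq hd hn]

theorem norm_abs_apply (X : H →L[ℂ] H) (v : H) : ‖CFC.abs X v‖ = ‖X v‖ := by
  have hs : star (CFC.abs X) = CFC.abs X := (CFC.abs_nonneg X).isSelfAdjoint
  have h : star (CFC.abs X) * CFC.abs X = star X * X := by rw [hs, CFC.abs_mul_abs]
  have h2 : ∀ Y : H →L[ℂ] H, ((‖Y v‖ ^ 2 : ℝ) : ℂ) = inner ℂ ((star Y * Y) v) v := by
    intro Y
    rw [ContinuousLinearMap.star_eq_adjoint, mul_apply_eq_comp,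
      ContinuousLinearMap.adjoint_inner_left, inner_self_eq_norm_sq_to_K]
    simp
  have h3 := (h2 (CFC.abs X)).trans ((congrArg (fun Z : H →L[ℂ] H => inner ℂ (Z v) v) h).trans
    (h2 X).symm)
  have h4 : ‖CFC.abs X v‖ ^ 2 = ‖X v‖ ^ 2 := by exact_mod_cast h3
  exact (sq_eq_sq₀ (norm_nonneg _) (norm_nonneg _)).1 h4

/-- Since X and |X| have equal norms at each vector, each is a left multiple of the other: X = U|X|
and |X| = VX. Hence X* = |X|U* = VXU*. -/
theorem star_mem (I : TwoSidedIdeal (H →L[ℂ] H)) {X : H →L[ℂ] H} (hX : X ∈ I) : star X ∈ I := by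
  obtain ⟨U, hU⟩ := exists_eq_mul_of_norm_le (fun v => (norm_abs_apply X v).ge)
  obtain ⟨V, hV⟩ := exists_eq_mul_of_norm_le (fun v => (norm_abs_apply X v).le)
  have hs : star (CFC.abs X) = CFC.abs X := (CFC.abs_nonneg X).isSelfAdjoint
  have : star X = V * X * star U := by
    conv_lhs => rw [hU, star_mul, hs]
    rw [← hV]
  rw [this]
  exact I.mul_mem_right _ _ (I.mul_mem_left _ _ hX)

theorem smul_mem (I : TwoSidedIdeal (H →L[ℂ] H)) (c : ℂ) {X : H →L[ℂ] H} (hX : X ∈ I) :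
    c • X ∈ I := by
  have := I.mul_mem_left (c • 1) X hX
  rwa [smul_mul_assoc, one_mul] at this

/-- A two-sided ideal of `B(H)` as a complex linear subspace. -/
def toSubmodule (I : TwoSidedIdeal (H →L[ℂ] H)) : Submodule ℂ (H →L[ℂ] H) where
  carrier := I
  zero_mem' := I.zero_mem
  add_mem' := I.add_mem
  smul_mem' c _ hX := smul_mem I c hX

theorem mem_toSubmodule {I : TwoSidedIdeal (H →L[ℂ] H)} {X : H →L[ℂ] H} :
    X ∈ toSubmodule I ↔ X ∈ I := Iff.rfl

theorem mul_mem_idealProd {I J : TwoSidedIdeal (H →L[ℂ] H)} {a b : H →L[ℂ] H} (ha : a ∈ I)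
    (hb : b ∈ J) : a * b ∈ idealProd I J := by
  rw [idealProd, TwoSidedIdeal.mem_mk']
  exact AddSubgroup.subset_closure ⟨a, ha, b, hb, rfl⟩

theorem idealProd_induction {I J : TwoSidedIdeal (H →L[ℂ] H)} (L : AddSubgroup (H →L[ℂ] H))
    (h : ∀ a ∈ I, ∀ b ∈ J, a * b ∈ L) {x : H →L[ℂ] H} (hx : x ∈ idealProd I J) : x ∈ L := by
  rw [idealProd, TwoSidedIdeal.mem_mk'] at hx
  refine (AddSubgroup.closure_le L).2 ?_ hx
  rintro _ ⟨a, ha, b, hb, rfl⟩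
  exact h a ha b hb

theorem idealProd_le_left (I J : TwoSidedIdeal (H →L[ℂ] H)) : idealProd I J ≤ I := fun _ hx =>
  idealProd_induction (toSubmodule I).toAddSubgroup (fun a ha b _ => I.mul_mem_right a b ha) hx

/-- Ideals are self-adjoint and the adjoint reverses products; this is what makes IJ = JI. -/
theorem mul_mem_idealProd_symm {I J : TwoSidedIdeal (H →L[ℂ] H)} {a b : H →L[ℂ] H} (ha : a ∈ I)
    (hb : b ∈ J) : b * a ∈ idealProd I J := by
  have := star_mem _ (mul_mem_idealProd (star_mem I ha) (star_mem J hb))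
  rwa [star_mul, star_star, star_star] at this

theorem idealProd_comm (I J : TwoSidedIdeal (H →L[ℂ] H)) : idealProd I J = idealProd J I := by
  apply le_antisymm <;>
  exact fun _ hx => idealProd_induction (toSubmodule (idealProd _ _)).toAddSubgroup
    (fun a ha b hb => mul_mem_idealProd_symm hb ha) hx

/-! ### Linear J-ideals and softness -/

theorem isLinearIdeal_toSubmodule {I J : TwoSidedIdeal (H →L[ℂ] H)} (h : I ≤ J) :
    IsLinearIdeal J (toSubmodule I) :=
  ⟨fun _ hx => h hx, fun a _ x hx => ⟨I.mul_mem_left a x hx, I.mul_mem_right x a hx⟩⟩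

theorem linearIdealSpan_le {J : TwoSidedIdeal (H →L[ℂ] H)} {𝒮 : Set (H →L[ℂ] H)}
    {L : Submodule ℂ (H →L[ℂ] H)} (hL : IsLinearIdeal J L) (h : 𝒮 ⊆ L) :
    linearIdealSpan J 𝒮 ≤ L := sInf_le ⟨hL, h⟩

theorem subset_linearIdealSpan (J : TwoSidedIdeal (H →L[ℂ] H)) (𝒮 : Set (H →L[ℂ] H)) :
    𝒮 ⊆ linearIdealSpan J 𝒮 := by
  intro x hx
  refine Submodule.mem_sInf.2 fun L hL => hL.2 hx

/-- A linear `J`-ideal generated inside a `J`-soft ideal `I = (𝒮)` is all of `I`. -/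
theorem linearIdealSpan_eq_of_isSoft {I J : TwoSidedIdeal (H →L[ℂ] H)} (hIJ : I ≤ J)
    (hsoft : IsSoft J I) {𝒮 : Set (H →L[ℂ] H)} (h𝒮 : TwoSidedIdeal.span 𝒮 = I) :
    linearIdealSpan J 𝒮 = toSubmodule I := by
  apply le_antisymm
  · refine linearIdealSpan_le (isLinearIdeal_toSubmodule hIJ) ?_
    rw [← h𝒮]
    exact TwoSidedIdeal.subset_span
  · refine le_sInf ?_
    rintro L ⟨⟨_, hL⟩, hSL⟩
    -- M = {x : JxJ ⊆ L} is an ideal of all of B(H), because the outer factors from J absorb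
    -- arbitrary bounded operators.
    let M : TwoSidedIdeal (H →L[ℂ] H) := TwoSidedIdeal.mk'
      {x | ∀ j ∈ J, ∀ k ∈ J, j * x * k ∈ L}
      (by intro j _ k _; simp)
      (by intro x y hx hy j hj k hk; rw [mul_add, add_mul]; exact add_mem (hx j hj k hk) (hy j hj k hk))
      (by intro x hx j hj k hk; rw [mul_neg, neg_mul]; exact neg_mem (hx j hj k hk))
      (by intro x y hy j hj k hk; rw [← mul_assoc]; exact hy _ (J.mul_mem_right _ _ hj) k hk)
      (by intro x y hx j hj k hk; rw [← mul_assoc, mul_assoc _ y k]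
          exact hx j hj _ (J.mul_mem_left _ _ hk))
    have hM : ∀ x, x ∈ M ↔ ∀ j ∈ J, ∀ k ∈ J, j * x * k ∈ L := fun x =>
      TwoSidedIdeal.mem_mk' ..
    have hIM : I ≤ M := by
      rw [← h𝒮, TwoSidedIdeal.span_le]
      intro x hx
      refine (hM x).2 fun j hj k hk => ?_
      exact (hL k hk _ (hL j hj x (hSL hx)).1).2
    intro x hx
    -- Softness is used on both sides: I = IJ = (JI)J, and JIJ ⊆ L.
    have hx' : x ∈ idealProd I J := by rw [hsoft]; exact hx
    refine idealProd_induction L.toAddSubgroup (fun a ha b hb => ?_) hx'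
    have ha' : a ∈ idealProd J I := by rw [idealProd_comm, hsoft]; exact ha
    refine idealProd_induction (L.toAddSubgroup.comap (AddMonoidHom.mulRight b))
      (fun j hj i hi => ?_) ha'
    exact (hM i).1 (hIM hi) j hj b hb

theorem linearIdealSpan_le_span_sup {I J : TwoSidedIdeal (H →L[ℂ] H)} (hIJ : I ≤ J)
    {𝒮 : Set (H →L[ℂ] H)} (h𝒮 : 𝒮 ⊆ I) :
    linearIdealSpan J 𝒮 ≤ Submodule.span ℂ 𝒮 ⊔ toSubmodule (idealProd I J) := by
  have hle : Submodule.span ℂ 𝒮 ⊔ toSubmodule (idealProd I J) ≤ toSubmodule I :=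
    sup_le (Submodule.span_le.2 h𝒮) (idealProd_le_left I J)
  refine linearIdealSpan_le ⟨fun x hx => hIJ (hle hx), fun a ha x hx => ⟨?_, ?_⟩⟩
    (Submodule.subset_span.trans (SetLike.coe_subset_coe.2 le_sup_left))
  · exact (le_sup_right : toSubmodule (idealProd I J) ≤ _) (mul_mem_idealProd_symm (hle hx) ha)
  · exact (le_sup_right : toSubmodule (idealProd I J) ≤ _) (mul_mem_idealProd (hle hx) ha)

/-! ### Operators diagonal in an orthonormal basis -/

theorem eq_of_eq_on_basis {ι : Type*} (e : HilbertBasis ι ℂ H) {A B : H →L[ℂ] H}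
    (h : ∀ k, A (e k) = B (e k)) : A = B := by
  refine ContinuousLinearMap.ext_on (s := Set.range e) ?_ ?_
  · rw [Submodule.dense_iff_topologicalClosure_eq_top]
    exact e.dense_span
  · rintro _ ⟨k, rfl⟩
    exact h k

theorem norm_sq_linearCombination {ι : Type*} {v : ι → H} (hv : Orthonormal ℂ v) (x : ι →₀ ℂ) :
    ‖Finsupp.linearCombination ℂ v x‖ ^ 2 = ∑ k ∈ x.support, ‖x k‖ ^ 2 := by
  rw [Finsupp.linearCombination_apply, Finsupp.sum]
  exact hv.orthogonalFamily.norm_sum x x.support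

theorem exists_diagonal {ι : Type*} (e : HilbertBasis ι ℂ H) (c : ι → ℂ) {M : ℝ} (hM : 0 ≤ M)
    (hc : ∀ k, ‖c k‖ ≤ M) : ∃ D : H →L[ℂ] H, (∀ k, D (e k) = c k • e k) ∧ ‖D‖ ≤ M := by
  let E : (ι →₀ ℂ) →ₗ[ℂ] H := Finsupp.linearCombination ℂ e
  let F : (ι →₀ ℂ) →ₗ[ℂ] H := Finsupp.linearCombination ℂ (fun k => c k • e k)
  have hd : DenseRange E := by
    have h := e.dense_span
    rw [← Submodule.dense_iff_topologicalClosure_eq_top, ← Finsupp.range_linearCombination] at h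
    exact h
  have hn : ∀ x, ‖F x‖ ≤ M * ‖E x‖ := by
    intro x
    refine le_of_sq_le_sq ?_ (by positivity)
    have hF : F x = ∑ k ∈ x.support, (x k * c k) • e k := by
      simp only [F, Finsupp.linearCombination_apply, Finsupp.sum, smul_smul]
    have hF2 : ‖F x‖ ^ 2 = ∑ k ∈ x.support, ‖x k * c k‖ ^ 2 := by
      rw [hF]
      exact e.orthonormal.orthogonalFamily.norm_sum (fun k => x k * c k) x.support
    rw [hF2, mul_pow, norm_sq_linearCombination e.orthonormal, Finset.mul_sum]
    refine Finset.sum_le_sum fun k _ => ?_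
    rw [norm_mul, mul_pow, mul_comm]
    gcongr
    exact hc k
  refine ⟨F.extendOfNorm E, fun k => ?_, LinearMap.opNorm_extendOfNorm_le hd hM hn⟩
  have := LinearMap.extendOfNorm_eq hd ⟨M, hn⟩ (Finsupp.single k 1)
  simpa [E, F] using this

theorem norm_diagonal_le {ι : Type*} (e : HilbertBasis ι ℂ H) {A : H →L[ℂ] H} {c : ι → ℂ}
    (hA : ∀ k, A (e k) = c k • e k) {M : ℝ} (hM : 0 ≤ M) (hc : ∀ k, ‖c k‖ ≤ M) : ‖A‖ ≤ M := by
  obtain ⟨D, hD, hDM⟩ := exists_diagonal e c hM hc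
  rwa [eq_of_eq_on_basis e (fun k => (hA k).trans (hD k).symm)]

theorem norm_diagonal_entry_le {ι : Type*} (e : HilbertBasis ι ℂ H) {A : H →L[ℂ] H} {c : ι → ℂ}
    (hA : ∀ k, A (e k) = c k • e k) (k : ι) : ‖c k‖ ≤ ‖A‖ := by
  have := A.le_opNorm (e k)
  rwa [hA, norm_smul, e.orthonormal.1 k, mul_one, mul_one] at this

/-- Both families embed ℓ²(κ) isometrically, by U and V; take W = VU*. -/
theorem exists_partialIsometry {κ : Type*} {u v : κ → H} (hu : Orthonormal ℂ u)
    (hv : Orthonormal ℂ v) : ∃ W : H →L[ℂ] H, ∀ k, W (u k) = v k := by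
  classical
  let U := hu.orthogonalFamily.linearIsometry
  let V := hv.orthogonalFamily.linearIsometry
  have hU : ∀ k, U (lp.single 2 k (1 : ℂ)) = u k := fun k => by
    simp [U, OrthogonalFamily.linearIsometry_apply_single]
  have hV : ∀ k, V (lp.single 2 k (1 : ℂ)) = v k := fun k => by
    simp [V, OrthogonalFamily.linearIsometry_apply_single]
  refine ⟨V.toContinuousLinearMap.comp U.toContinuousLinearMap.adjoint, fun k => ?_⟩
  have h : U.toContinuousLinearMap.adjoint (u k) = lp.single 2 k (1 : ℂ) := by
    rw [← hU k]
    exact congrArg (fun Z => Z (lp.single 2 k (1 : ℂ)))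
      (ContinuousLinearMap.norm_map_iff_adjoint_comp_self U.toContinuousLinearMap |>.1
        (fun x => U.norm_map x))
  rw [ContinuousLinearMap.comp_apply, h]
  exact hV k

/-! ### s-numbers of diagonal operators -/

theorem sNumber_le {T F : H →L[ℂ] H} {n : ℕ} (hF : (F : H →ₗ[ℂ] H).rank ≤ (n : Cardinal)) :
    sNumber T n ≤ ‖T - F‖ := by
  refine csInf_le ⟨0, ?_⟩ ⟨F, hF, rfl⟩
  rintro _ ⟨_, _, rfl⟩
  exact norm_nonneg _

/-- If all but `n` diagonal entries are at most `m` in modulus, the `n`-th s-number is too. -/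
theorem sNumber_diagonal_le {ι : Type*} (e : HilbertBasis ι ℂ H) {S : H →L[ℂ] H} {d : ι → ℂ}
    (hS : ∀ k, S (e k) = d k • e k) {m : ℝ} (hm : 0 ≤ m) (s : Finset ι)
    (hs : ∀ k ∉ s, ‖d k‖ ≤ m) : sNumber S s.card ≤ m := by
  classical
  obtain ⟨F, hF, -⟩ := exists_diagonal e (fun k => if k ∈ s then d k else 0) (norm_nonneg S)
    (fun k => by
      split_ifs
      · exact norm_diagonal_entry_le e hS k
      · simp)
  have hrank : (F : H →ₗ[ℂ] H).rank ≤ (s.card : Cardinal) := by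
    have hfd : FiniteDimensional ℂ (Submodule.span ℂ (s.image e : Set H)) :=
      FiniteDimensional.span_finset ℂ _
    have hr : LinearMap.range (F : H →ₗ[ℂ] H) ≤ Submodule.span ℂ (s.image e : Set H) := by
      let K := Submodule.span ℂ (s.image e : Set H)
      have hK : IsClosed (K : Set H) := K.closed_of_finiteDimensional
      have hle : (⊤ : Submodule ℂ H) ≤ K.comap (F : H →ₗ[ℂ] H) := by
        rw [← e.dense_span]
        refine Submodule.topologicalClosure_minimal _ ?_ (hK.preimage F.continuous)
        rw [Submodule.span_le]
        rintro _ ⟨k, rfl⟩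
        simp only [Submodule.comap_coe, Set.mem_preimage, ContinuousLinearMap.coe_coe, hF,
          SetLike.mem_coe]
        split_ifs with hk
        · exact K.smul_mem _ (Submodule.subset_span (by simpa using ⟨k, hk, rfl⟩))
        · simp
      rintro _ ⟨x, rfl⟩
      exact hle Submodule.mem_top
    calc (F : H →ₗ[ℂ] H).rank ≤ Module.rank ℂ (Submodule.span ℂ (s.image e : Set H)) :=
          Submodule.rank_mono hr
      _ ≤ ((s.image e).card : Cardinal) := rank_span_finset_le _
      _ ≤ s.card := by exact_mod_cast Finset.card_image_le
  refine (sNumber_le hrank).trans (norm_diagonal_le e (c := fun k => if k ∈ s then 0 else d k) ?_ hm ?_)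
  · intro k
    rw [sub_apply, hS, hF]
    split_ifs <;> simp
  · intro k
    split_ifs with hk
    · simpa using hm
    · exact hs k hk

/-- If more than `n` diagonal entries are at least `m` in modulus, so is the `n`-th s-number. -/
theorem le_sNumber_diagonal {ι : Type*} (e : HilbertBasis ι ℂ H) {T : H →L[ℂ] H} {d : ι → ℂ}
    (hT : ∀ k, T (e k) = d k • e k) {m : ℝ} (hm : 0 < m) (s : Finset ι)
    (hs : ∀ k ∈ s, m ≤ ‖d k‖) {n : ℕ} (hn : n < s.card) : m ≤ sNumber T n := by
  classical
  refine le_csInf ⟨_, 0, by simp [LinearMap.rank_zero], rfl⟩ ?_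
  rintro _ ⟨F, hF, rfl⟩
  -- R inverts T on the span of the e k with k ∈ s, with norm at most 1/m.
  obtain ⟨R, hR, hRm⟩ := exists_diagonal e (fun k => if k ∈ s then (d k)⁻¹ else 0)
    (inv_nonneg.2 hm.le) (fun k => by
      split_ifs with hk
      · rw [norm_inv]
        exact inv_anti₀ hm (hs k hk)
      · simpa using hm.le)
  let g : (s → ℂ) →ₗ[ℂ] H := Fintype.linearCombination ℂ (fun k : s => e k)
  have hg : Function.Injective g :=
    linearIndependent_iff_injective_fintypeLinearCombination.1
      (e.orthonormal.linearIndependent.comp _ Subtype.val_injective)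
  -- That span has dimension above n, so F, of rank at most n, kills a nonzero vector in it; there T
  -- - F agrees with T.
  obtain ⟨a, ha0, ha⟩ : ∃ a : s → ℂ, a ≠ 0 ∧ F (g a) = 0 := by
    by_contra! hcon
    have hinj : Function.Injective ((F : H →ₗ[ℂ] H).comp g) := by
      rw [injective_iff_map_eq_zero]
      intro a ha
      by_contra h0
      exact hcon a h0 ha
    have h1 := LinearMap.lift_rank_le_of_injective
      (((F : H →ₗ[ℂ] H).comp g).codRestrict (LinearMap.range (F : H →ₗ[ℂ] H))
        (fun a => LinearMap.mem_range_self _ _))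
      (LinearMap.injective_codRestrict_iff _ |>.2 hinj)
    have h2 := h1.trans (Cardinal.lift_le.2 hF)
    simp only [rank_fun', Fintype.card_coe, Cardinal.lift_natCast, Nat.cast_le] at h2
    omega
  have hRT : R (T (g a)) = g a := by
    simp only [g, Fintype.linearCombination_apply, map_sum, map_smul, hT, hR]
    refine Finset.sum_congr rfl fun k _ => ?_
    have : d k ≠ 0 := norm_pos_iff.1 (hm.trans_le (hs k k.2))
    simp [this]
  have hga : 0 < ‖g a‖ := norm_pos_iff.2 fun h => ha0 (hg (h.trans (map_zero g).symm))
  have h1 : ‖g a‖ ≤ m⁻¹ * (‖T - F‖ * ‖g a‖) := by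
    calc ‖g a‖ = ‖R ((T - F) (g a))‖ := by rw [sub_apply, ha, sub_zero, hRT]
      _ ≤ ‖R‖ * ‖(T - F) (g a)‖ := R.le_opNorm _
      _ ≤ m⁻¹ * (‖T - F‖ * ‖g a‖) := by
        gcongr
        exact (T - F).le_opNorm _
  rw [← mul_assoc, le_mul_iff_one_le_left hga, le_inv_mul_iff₀ hm, mul_one] at h1
  exact h1

/-- Comparison of s-numbers of diagonal operators yields a comparison of diagonal entries along an
injection. -/
theorem exists_injective_norm_le (e : HilbertBasis ℕ ℂ H) {S T : H →L[ℂ] H} {d₁ d₂ : ℕ → ℂ}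
    (hS : ∀ k, S (e k) = d₁ k • e k) (hT : ∀ k, T (e k) = d₂ k • e k) {b : ℝ} (hb : 0 < b)
    (h : ∀ n, sNumber T n ≤ b * sNumber S n) :
    ∃ (C : ℝ) (π : Function.support d₂ → ℕ), 0 ≤ C ∧ Function.Injective π ∧
      ∀ k : Function.support d₂, ‖d₂ k‖ ≤ C * ‖d₁ (π k)‖ := by
  classical
  -- Admissible targets for k; the factor 2 leaves the slack that makes the contradiction below
  -- strict.
  let t : Function.support d₂ → Set ℕ := fun k => {j | ‖d₂ k‖ ≤ 2 * b * ‖d₁ j‖}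
  by_cases hfin : ∀ k, (t k).Finite
  -- Hall's marriage theorem. The sets t k are nested, so the smallest entry over s has the largest
  -- one, t k₀. If it had n < |s| elements, the n-th s-numbers would satisfy s(S) ≤ ‖d₂ k₀‖/(2b) and
  -- s(T) ≥ ‖d₂ k₀‖.
  · obtain ⟨π, hπ, hπt⟩ := (Finset.all_card_le_biUnion_card_iff_exists_injective
      (fun k => (hfin k).toFinset)).1 (fun s => by
        rcases s.eq_empty_or_nonempty with rfl | hne
        · simp
        obtain ⟨k₀, hk₀, hmin⟩ := s.exists_min_image (fun k => ‖d₂ k‖) hne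
        refine le_trans ?_ (Finset.card_le_card (Finset.subset_biUnion_of_mem
          (fun k => (hfin k).toFinset) hk₀))
        by_contra! hlt
        have hpos : 0 < ‖d₂ k₀‖ := norm_pos_iff.2 k₀.2
        have h1 := sNumber_diagonal_le e hS (m := ‖d₂ k₀‖ / (2 * b)) (by positivity)
          (hfin k₀).toFinset (fun j hj => by
            simp only [t, Set.Finite.mem_toFinset, Set.mem_ofPred_eq, not_le] at hj
            rw [le_div_iff₀ (by positivity), mul_comm]
            exact hj.le)
        have h2 := le_sNumber_diagonal e hT hpos (s.map (Function.Embedding.subtype _))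
          (fun k hk => by
            obtain ⟨k', hk', rfl⟩ := Finset.mem_map.1 hk
            exact hmin k' hk') (n := (hfin k₀).toFinset.card) (by rwa [Finset.card_map])
        have h3 := h2.trans ((h _).trans (mul_le_mul_of_nonneg_left h1 hb.le))
        have h4 : b * (‖d₂ k₀‖ / (2 * b)) = ‖d₂ k₀‖ / 2 := by field_simp
        rw [h4] at h3
        linarith)
    refine ⟨2 * b, π, by positivity, hπ, fun k => ?_⟩
    simpa [t] using hπt k
  · push Not at hfin
    obtain ⟨k₀, hk₀⟩ := hfin
    have hpos : 0 < ‖d₂ k₀‖ := norm_pos_iff.2 k₀.2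
    -- Infinitely many entries of S are bounded away from 0, so any injection into them works, as
    -- the entries of T are at most ‖T‖.
    let φ := Set.Infinite.natEmbedding (t k₀) hk₀
    refine ⟨‖T‖ * (2 * b) / ‖d₂ k₀‖, fun k => φ k, by positivity, ?_, fun k => ?_⟩
    · exact fun x y hxy => Subtype.ext (φ.injective (Subtype.ext hxy))
    · have h1 : ‖d₂ k₀‖ ≤ 2 * b * ‖d₁ (φ k)‖ := (φ k).2
      calc ‖d₂ k‖ ≤ ‖T‖ := norm_diagonal_entry_le e hT k
        _ = ‖T‖ / ‖d₂ k₀‖ * ‖d₂ k₀‖ := by field_simp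
        _ ≤ ‖T‖ / ‖d₂ k₀‖ * (2 * b * ‖d₁ (φ k)‖) := by gcongr
        _ = ‖T‖ * (2 * b) / ‖d₂ k₀‖ * ‖d₁ (φ k)‖ := by ring

/-- With π the injection above, T = VSWD: D scales e k by d₂ k / d₁ (π k), W sends e k to e (π k),
and V sends it back. -/
theorem mem_of_sNumber_le (e : HilbertBasis ℕ ℂ H) {S T : H →L[ℂ] H} {d₁ d₂ : ℕ → ℂ}
    (hS : ∀ k, S (e k) = d₁ k • e k) (hT : ∀ k, T (e k) = d₂ k • e k) {b : ℝ} (hb : 0 < b)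
    (h : ∀ n, sNumber T n ≤ b * sNumber S n) {I : TwoSidedIdeal (H →L[ℂ] H)} (hSI : S ∈ I) :
    T ∈ I := by
  classical
  obtain ⟨C, π, hC, hπ, hle⟩ := exists_injective_norm_le e hS hT hb h
  have hu : Orthonormal ℂ (fun k : Function.support d₂ => e k) :=
    e.orthonormal.comp _ Subtype.val_injective
  have hv : Orthonormal ℂ (fun k : Function.support d₂ => e (π k)) := e.orthonormal.comp _ hπ
  obtain ⟨W, hW⟩ := exists_partialIsometry hu hv
  obtain ⟨V, hV⟩ := exists_partialIsometry hv hu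
  have hd₁ : ∀ k, d₁ (π k) ≠ 0 := fun k h0 => by
    have := hle k
    rw [h0, norm_zero, mul_zero] at this
    exact k.2 (norm_le_zero_iff.1 this)
  obtain ⟨D, hD, -⟩ := exists_diagonal e
    (fun k => if hk : k ∈ Function.support d₂ then d₂ k / d₁ (π ⟨k, hk⟩) else 0) hC (fun k => by
      split_ifs with hk
      · rw [norm_div, div_le_iff₀ (norm_pos_iff.2 (hd₁ _))]
        exact hle ⟨k, hk⟩
      · simpa using hC)
  have hTe : T = V * S * (W * D) := by
    refine eq_of_eq_on_basis e fun k => ?_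
    simp only [mul_apply_eq_comp, hD, hT]
    split_ifs with hk
    · rw [map_smul, hW ⟨k, hk⟩, map_smul, hS, map_smul, map_smul, hV ⟨k, hk⟩, smul_smul,
        div_mul_cancel₀ _ (hd₁ _)]
    · have : d₂ k = 0 := Function.notMem_support.1 hk
      simp [this]
  rw [hTe]
  exact I.mul_mem_right _ _ (I.mul_mem_left _ _ hSI)

theorem exists_projection (e : HilbertBasis ℕ ℂ H) {S T : H →L[ℂ] H} {d₁ d₂ : ℕ → ℂ}
    (hS : ∀ k, S (e k) = d₁ k • e k) (hT : ∀ k, T (e k) = d₂ k • e k)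
    (hd : Disjoint (Function.support d₁) (Function.support d₂)) :
    ∃ P : H →L[ℂ] H, P * S = S ∧ P * T = 0 := by
  classical
  obtain ⟨P, hP, -⟩ := exists_diagonal e (fun k => if d₁ k = 0 then 0 else 1) zero_le_one
    (fun k => by split_ifs <;> simp)
  refine ⟨P, eq_of_eq_on_basis e fun k => ?_, eq_of_eq_on_basis e fun k => ?_⟩
  · rw [mul_apply_eq_comp, hS, map_smul, hP]
    split_ifs with h <;> simp [h]
  · rw [mul_apply_eq_comp, hT, map_smul, hP]
    split_ifs with h
    · simp
    · have : d₂ k = 0 := Function.notMem_support.1 (Set.disjoint_left.1 hd h)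
      simp [this]

end Subideal

end

theorem proposition6 {H : Type*} [NormedAddCommGroup H] [InnerProductSpace ℂ H]
    [CompleteSpace H] [TopologicalSpace.SeparableSpace H] (hH : ¬ FiniteDimensional ℂ H)
    (J : TwoSidedIdeal (H →L[ℂ] H)) (S T : H →L[ℂ] H) (hS : S ∈ J) (hT : T ∈ J)
    (hdiag : Subideal.SimulDiagDisjoint S T) (hs : Subideal.SNumberEquiv S T) :
    Subideal.IsPrincipalLinearIdeal J (Subideal.linearIdealSpan J {S, T}) ↔
      Subideal.IsSoft J (TwoSidedIdeal.span {S, T}) := by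
  open Subideal in
  obtain ⟨e, d₁, d₂, hSe, hTe, hd⟩ := hdiag
  obtain ⟨a, b, ha, hb, hab⟩ := hs
  obtain ⟨P, hPS, hPT⟩ := exists_projection e hSe hTe hd
  obtain ⟨I, hI⟩ : ∃ I : TwoSidedIdeal (H →L[ℂ] H), TwoSidedIdeal.span {S, T} = I := ⟨_, rfl⟩
  have hIle : ∀ K : TwoSidedIdeal (H →L[ℂ] H), S ∈ K → T ∈ K → I ≤ K := fun K h1 h2 => by
    rw [← hI, TwoSidedIdeal.span_le]
    rintro _ (rfl | rfl)
    exacts [h1, h2]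
  have hsub : ({S, T} : Set (H →L[ℂ] H)) ⊆ I := hI ▸ TwoSidedIdeal.subset_span
  have hSI : S ∈ I := hsub (by simp)
  have hTI : T ∈ I := hsub (by simp)
  have hIJ : I ≤ J := hIle J hS hT
  rw [hI]
  constructor
  · rintro ⟨A, hAJ, hA⟩
    have hsup : linearIdealSpan J {S, T} ≤ _ := linearIdealSpan_le_span_sup hIJ hsub
    have hAmem : A ∈ linearIdealSpan J {S, T} := by
      rw [hA]
      exact subset_linearIdealSpan J _ rfl
    have hAI : A ∈ I :=
      (linearIdealSpan_le (isLinearIdeal_toSubmodule hIJ) hsub : linearIdealSpan J {S, T} ≤ _) hAmem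
    obtain ⟨y, hy, z, hz, hyz⟩ := Submodule.mem_sup.1 (hsup hAmem)
    obtain ⟨α, β, rfl⟩ := Submodule.mem_span_pair.1 hy
    have hA2 : ∀ x ∈ ({S, T} : Set (H →L[ℂ] H)), ∃ γ : ℂ, x - γ • A ∈ idealProd I J := by
      intro x hx
      have hx' : x ∈ linearIdealSpan J {A} := hA ▸ subset_linearIdealSpan J _ hx
      obtain ⟨y, hy, z, hz, rfl⟩ := Submodule.mem_sup.1
        (linearIdealSpan_le_span_sup hIJ (Set.singleton_subset_iff.2 hAI) hx')
      obtain ⟨γ, rfl⟩ := Submodule.mem_span_singleton.1 hy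
      exact ⟨γ, by simpa using mem_toSubmodule.1 hz⟩
    obtain ⟨γ, hγ⟩ := hA2 S (by simp)
    obtain ⟨δ, hδ⟩ := hA2 T (by simp)
    have hS_of_T : T ∈ idealProd I J → S ∈ idealProd I J := fun h =>
      mem_of_sNumber_le e hTe hSe (inv_pos.2 ha)
        (fun n => by rw [le_inv_mul_iff₀ ha]; exact (hab n).1) h
    have hT_of_S : S ∈ idealProd I J → T ∈ idealProd I J := fun h =>
      mem_of_sNumber_le e hSe hTe hb (fun n => (hab n).2) h
    have hSmem : S ∈ idealProd I J := by
      by_cases hδ0 : δ = 0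
      · exact hS_of_T (by simpa [hδ0] using hδ)
      -- A cancels from δ(S - γA) - γ(T - δA); then P removes T and leaves δS.
      · have h1 : δ • S - γ • T ∈ idealProd I J := by
          have := (idealProd I J).sub_mem (smul_mem _ δ hγ) (smul_mem _ γ hδ)
          rwa [smul_sub, smul_sub, smul_smul, smul_smul, mul_comm δ γ, sub_sub_sub_cancel_right]
            at this
        have h2 := smul_mem _ δ⁻¹ ((idealProd I J).mul_mem_left P _ h1)
        rwa [mul_sub, mul_smul_comm, mul_smul_comm, hPS, hPT, smul_zero, sub_zero, smul_smul,
          inv_mul_cancel₀ hδ0, one_smul] at h2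
    exact le_antisymm (idealProd_le_left I J) (hIle _ hSmem (hT_of_S hSmem))
  · intro hsoft
    refine ⟨S + T, J.add_mem hS hT, ?_⟩
    rw [linearIdealSpan_eq_of_isSoft hIJ hsoft hI, linearIdealSpan_eq_of_isSoft hIJ hsoft]
    have hmem : S + T ∈ TwoSidedIdeal.span {S + T} := TwoSidedIdeal.subset_span rfl
    have hSm : S ∈ TwoSidedIdeal.span {S + T} := by
      have := TwoSidedIdeal.mul_mem_left _ P _ hmem
      rwa [mul_add, hPS, hPT, add_zero] at this
    have hTm : T ∈ TwoSidedIdeal.span {S + T} := by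
      simpa using TwoSidedIdeal.sub_mem _ hmem hSm
    refine le_antisymm ?_ (hIle _ hSm hTm)
    rw [TwoSidedIdeal.span_le, Set.singleton_subset_iff]
    exact I.add_mem hSI hTI
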